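/- Fix a standard acceptable enumeration $(\varphi_e)_{e\in\mathbb N}$ of the partial computable functions $\mathbb N\rightharpoonup\mathbb N$, let $W_e=\operatorname{dom}\varphi_e$, and let $\mathrm{COF}=\{e:\mathbb N\setminus W_e\text{ is finite}\}$. A number $e=\langle a,b\rangle$ is an index of a recursive presentation if $\varphi_a$ is total and is the characteristic function of a set $X\subseteq\mathbb N$ (the set of generators $\{x_n : n\in X\}$), and every element of $W_b$ is the code of a word on these generators and their inverses; the presented group is $\langle x_n\ (n\in X)\mid w\ (w\text{ a word with code in }W_b)\rangle$. Let $A$ be the set of all indices of recursive presentations, and $B$ the set of those $e\in A$ whose presented group is finite. **Theorem.** Detecting finiteness is $\Sigma^0_3$-complete in the class of recursively presented groups. That is: 1. there is a $\Sigma^0_3$ predicate $\psi$ on $\mathbb N$ with $B=A\cap\{e:\psi(e)\}$; 2. for every $\Sigma^0_3$ set $S\subseteq\mathbb N$ there is a computable function $f:\mathbb N\to\mathbb N$ with $f(e)\in A$ for all $e$, such that for all $e$, $e\in S$ if and only if $f(e)\in B$. Moreover, there is a computable function $f:\mathbb N\to\mathbb N$ such that for every $e$, $f(e)\in A$ is an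 index of a presentation with generating set $\{x_i:i\in\mathbb N\}$ and relators (as a set of elements of the free group) $[x_i,x_j]=x_i^{-1}x_j^{-1}x_ix_j$ and $x_i^2$ for all $i,j\in\mathbb N$, and $x_k$ for all $k\in W_e$; the group $G_e$ so presented satisfies $G_e\cong\mathbb Z_2^n$ if $|\mathbb N\setminus W_e|=n$ is finite, and $G_e\cong\bigoplus_{i\in\mathbb N}\mathbb Z_2$ if $\mathbb N\setminus W_e$ is infinite. In particular $e\in\mathrm{COF}$ if and only if $f(e)\in B$. -/

import Mathlib

namespace RecPres

/-- Predicates of level `n` of the arithmetical hierarchy, on a type with a standard coding.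
`IsSigma 0` is computability; `p` is in class `n + 1` when `p a ↔ ∃ x, q (a, x)` where `q` is
the negation of a predicate of class `n`.  Unfolded, this is a prefix of `n` alternating
number quantifiers, the first one existential, in front of a computable matrix. -/
def IsSigma : ℕ → {α : Type} → [Primcodable α] → (α → Prop) → Prop
  | 0, _, _, p => ComputablePred p
  | n + 1, α, _, p =>
      ∃ q : α × ℕ → Prop, IsSigma n (fun b => ¬ q b) ∧ ∀ a, p a ↔ ∃ x : ℕ, q (a, x)

/-- The `e`-th partial computable function. -/
def phi (e : ℕ) : ℕ →. ℕ := (Denumerable.ofNat Nat.Partrec.Code e).eval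

/-- The `e`-th computably enumerable set, the domain of `phi e`. -/
def W (e : ℕ) : Set ℕ := {n | (phi e n).Dom}

/-- Indices of cofinite computably enumerable sets. -/
def COF : Set ℕ := {e | (W e)ᶜ.Finite}

/-- The generators `x_n` of the presentation with index `e = ⟨a, b⟩`: those `n` with
`phi a n = 1`. -/
def gens (e : ℕ) : Set ℕ := {n | 1 ∈ phi e.unpair.1 n}

/-- The relators of the presentation with index `e = ⟨a, b⟩`: the words on the generators and
their inverses whose codes lie in `W b`.  A word is a list of letters `(x, true)` for `x` and
`(x, false)` for `x⁻¹`. -/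
def relators (e : ℕ) : Set (FreeGroup (gens e)) :=
  {r | ∃ w : List (gens e × Bool),
    Encodable.encode (w.map (fun l => ((l.1 : ℕ), l.2))) ∈ W e.unpair.2 ∧ r = FreeGroup.mk w}

/-- The index set of recursive presentations: `e = ⟨a, b⟩` such that `phi a` is the (total)
characteristic function of the set of generators and every element of `W b` is the code of a
word on these generators and their inverses. -/
def rpIndices : Set ℕ :=
  {e | (∀ n, phi e.unpair.1 n = Part.some 0 ∨ phi e.unpair.1 n = Part.some 1) ∧
    ∀ m ∈ W e.unpair.2, ∃ w : List (ℕ × Bool), Encodable.encode w = m ∧ ∀ l ∈ w, l.1 ∈ gens e}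

/-- The group given by the presentation with index `e`. -/
abbrev RPGroup (e : ℕ) : Type := PresentedGroup (relators e)

/-- The indices in `A` of presentations of groups which have the property `P`. -/
def indicesWith (A : Set ℕ) (P : (G : Type) → [Group G] → Prop) : Set ℕ :=
  {e | e ∈ A ∧ P (RPGroup e)}

/-- Detecting `P` is `Γ` in `A`. -/
def DetectIn (Γ : (ℕ → Prop) → Prop) (A : Set ℕ) (P : (G : Type) → [Group G] → Prop) : Prop :=
  ∃ ψ : ℕ → Prop, Γ ψ ∧ A ∩ {e | ψ e} = indicesWith A P

/-- Detecting `P` is `Γ`-hard in `A`. -/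
def DetectHard (Γ : (ℕ → Prop) → Prop) (A : Set ℕ) (P : (G : Type) → [Group G] → Prop) : Prop :=
  ∀ S : ℕ → Prop, Γ S → ∃ f : ℕ → ℕ, Computable f ∧ (∀ e, f e ∈ A) ∧
    ∀ e, S e ↔ f e ∈ indicesWith A P

/-- Detecting `P` is `Γ`-complete in `A`. -/
def DetectComplete (Γ : (ℕ → Prop) → Prop) (A : Set ℕ)
    (P : (G : Type) → [Group G] → Prop) : Prop :=
  DetectIn Γ A P ∧ DetectHard Γ A P

/-- The relators `[x_i, x_j]` and `x_i ^ 2` for all `i, j`, and `x_k` for `k ∈ W e`, where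
`[x, y] = x⁻¹ y⁻¹ x y`. -/
def cofRelators (e : ℕ) : Set (FreeGroup ℕ) :=
  {r | ∃ i j : ℕ, r = (FreeGroup.of i)⁻¹ * (FreeGroup.of j)⁻¹ * FreeGroup.of i * FreeGroup.of j} ∪
  {r | ∃ i : ℕ, r = FreeGroup.of i ^ 2} ∪
  {r | ∃ k ∈ W e, r = FreeGroup.of k}

end RecPres

/-! Upper bound: after non-generators are added as relators, every presentation lives on the free
group on `ℕ`. The group is finite iff there is a finite list of words such that every word equals an
entry of the list modulo the relators. That equality is witnessed by a product of conjugates of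
relators, which is computably checkable once the stages enumerating the relators are supplied. The
prefix is ∃∀∃ (`isSigma_finite_fullRelators`, `finite_rpGroup_iff`).

Hardness: every Σ₃ set reduces to `COF` (`exists_reduction_to_COF`), and `COF` reduces to finiteness
by an elementary abelian 2-group with one free coordinate for each element outside `W e`
(`nonempty_mulEquiv_cofRelators`, `exists_cof_index`). The first reduction builds a sequence `t` in
which some value recurs infinitely often iff the Σ₃ statement holds. It enumerates the stages at
which a later value of `t` is no larger; cofinitely many stages are enumerated iff some value recurs
infinitely often. -/

open Nat.Partrec (Code)

/-! ### Closure properties of computable predicates. -/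

theorem ComputablePred.comp {α β : Type*} [Primcodable α] [Primcodable β] {p : β → Prop}
    {f : α → β} (hp : ComputablePred p) (hf : Computable f) : ComputablePred fun a => p (f a) := by
  obtain ⟨g, hg, rfl⟩ := ComputablePred.computable_iff.1 hp
  exact ComputablePred.computable_iff.2 ⟨_, hg.comp hf, rfl⟩

theorem ComputablePred.and {α : Type*} [Primcodable α] {p q : α → Prop}
    (hp : ComputablePred p) (hq : ComputablePred q) : ComputablePred fun a => p a ∧ q a := by
  obtain ⟨f, hf, rfl⟩ := ComputablePred.computable_iff.1 hp
  obtain ⟨g, hg, rfl⟩ := ComputablePred.computable_iff.1 hq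
  exact ComputablePred.computable_iff.2
    ⟨fun a => f a && g a, (Primrec₂.to_comp Primrec.and).comp hf hg, by funext a; simp⟩

theorem ComputablePred.forall_lt {α : Type*} [Primcodable α] {p : α × ℕ → Prop}
    (hp : ComputablePred p) : ComputablePred fun a : α × ℕ => ∀ y < a.2, p (a.1, y) := by
  obtain ⟨f, hf, rfl⟩ := ComputablePred.computable_iff.1 hp
  refine ComputablePred.computable_iff.2
    ⟨fun a : α × ℕ => Nat.rec (motive := fun _ => Bool) true (fun y b => b && f (a.1, y)) a.2,
      ?_, ?_⟩
  · refine Computable.nat_rec (h := fun (a : α × ℕ) (p : ℕ × Bool) => p.2 && f (a.1, p.1))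
      Computable.snd (Computable.const true) ?_
    exact (Primrec₂.to_comp Primrec.and).comp (Computable.snd.comp Computable.snd)
      (hf.comp (Computable.pair (Computable.fst.comp Computable.fst)
        (Computable.fst.comp Computable.snd)))
  · funext ⟨a, n⟩
    induction n with
    | zero => simp
    | succ n ih =>
      have ih' := iff_of_eq ih
      simp only [Bool.and_eq_true, eq_iff_iff] at ih' ⊢
      rw [← ih', Nat.forall_lt_succ_right]

theorem ComputablePred.exists_lt {α : Type*} [Primcodable α] {p : α × ℕ → Prop}
    (hp : ComputablePred p) : ComputablePred fun a : α × ℕ => ∃ y < a.2, p (a.1, y) :=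
  (ComputablePred.forall_lt hp.not).not.of_eq fun a => by push Not; rfl

/-! ### Reduction of Σ₃ sets to `COF`. -/

namespace RecPres

theorem isSigma_three_iff {p : ℕ → Prop} :
    IsSigma 3 p ↔ ∃ R : ((ℕ × ℕ) × ℕ) × ℕ → Prop, ComputablePred R ∧
      ∀ e, p e ↔ ∃ x, ∀ y, ∃ z, R (((e, x), y), z) := by
  constructor
  · rintro ⟨q, ⟨q', ⟨q'', h, h''⟩, h'⟩, hp⟩
    refine ⟨q'', h.not.of_eq fun a => not_not, fun e => ?_⟩
    rw [hp]
    refine exists_congr fun x => ?_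
    rw [← not_not (a := q (e, x)), show ¬ q (e, x) ↔ _ from h' _, not_exists]
    exact forall_congr' fun y => h'' _
  · rintro ⟨R, hR, hp⟩
    refine ⟨fun a => ∀ y, ∃ z, R ((a, y), z), ⟨fun a => ¬ ∃ z, R (a, z),
      ⟨R, hR.not, fun b => not_not⟩, fun a => ?_⟩, hp⟩
    push Not; rfl

theorem mem_W_iff {e m : ℕ} :
    m ∈ W e ↔ ∃ k, (Code.evaln k (Denumerable.ofNat Code e) m).isSome = true := by
  simp only [W, phi, Set.mem_ofPred_eq, Part.dom_iff_mem, Code.evaln_complete,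
    Option.isSome_iff_exists, Option.mem_def]
  exact exists_comm

/-- Unbounded search for `z` has domain the projection of `p`; currying its code (s-m-n) gives the
index uniformly in `e`. -/
theorem exists_W_index {p : (ℕ × ℕ) × ℕ → Prop} (hp : ComputablePred p) :
    ∃ g : ℕ → ℕ, Computable g ∧ ∀ e m, m ∈ W (g e) ↔ ∃ z, p ((e, m), z) := by
  obtain ⟨f, hf, rfl⟩ := ComputablePred.computable_iff.1 hp
  have hF : Nat.Partrec fun a : ℕ => Nat.rfind fun z => Part.some (f (a.unpair, z)) := by
    refine Partrec.nat_iff.1 (Partrec.rfind ?_)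
    exact (hf.comp (Computable.pair (Computable.unpair.comp Computable.fst)
      Computable.snd)).partrec
  obtain ⟨c, hc⟩ := Code.exists_code.1 hF
  refine ⟨fun e => Encodable.encode (Code.curry c e),
    Computable.encode.comp (Code.primrec₂_curry.to_comp.comp (Computable.const c) Computable.id),
    fun e m => ?_⟩
  simp only [W, phi, Set.mem_ofPred_eq, Denumerable.ofNat_encode, Code.eval_curry, hc,
    Nat.unpair_pair]
  exact Nat.rfind_dom'.trans (by simp)

/-- The complement consists of the stages after which all values of `t` are strictly larger. If all
fibers are finite, the last occurrence of the least value taken after `N` is such a stage beyond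
`N`. If `x` recurs infinitely often, `t` is injective on these stages with values below `x`. -/
theorem finite_compl_iff_exists_infinite_fiber (t : ℕ → ℕ) :
    {s | ∃ s' > s, t s' ≤ t s}ᶜ.Finite ↔ ∃ x, {s | t s = x}.Infinite := by
  constructor
  · contrapose!
    intro h
    refine Set.infinite_of_not_bddAbove fun ⟨N, hN⟩ => ?_
    have hne : ∃ m, ∃ s > N, t s = m := ⟨_, N + 1, Nat.lt_succ_self N, rfl⟩
    classical
    obtain ⟨s, hs, hts⟩ := Nat.find_spec hne
    have hfin : {s | t s = Nat.find hne}.Finite := Set.not_infinite.1 (by simpa using h _)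
    obtain ⟨s₁, hs₁, hmax⟩ := hfin.exists_maximal ⟨s, hts⟩
    have hle : s ≤ s₁ := (le_total s s₁).elim id fun h => hmax hts h
    refine absurd (hN (a := s₁) ?_) (by omega)
    rintro ⟨s', hs', hle'⟩
    have h1 : Nat.find hne ≤ t s' := Nat.find_min' hne ⟨s', by omega, rfl⟩
    have h2 : t s' = Nat.find hne := le_antisymm (hle'.trans_eq hs₁) h1
    have := hmax h2 hs'.le
    omega
  · rintro ⟨x, hx⟩
    refine Set.Finite.of_injOn (f := t) (t := Set.Iio x) (fun s hs => ?_) ?_ (Set.finite_Iio x)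
    · obtain ⟨s', hs', hlt⟩ := hx.exists_gt s
      by_contra hle
      exact hs ⟨s', hlt, hs'.trans_le (not_lt.1 hle)⟩
    · intro s hs s' hs' heq
      rcases lt_trichotomy s s' with h | h | h
      · exact absurd ⟨s', h, heq.ge⟩ hs
      · exact h
      · exact absurd ⟨s, h, heq.le⟩ hs'

/-- `v` is the least bound on witnesses of `R y` for `y < n`. -/
def LeastBound (R : ℕ → ℕ → Prop) (n v : ℕ) : Prop :=
  (∀ y < n, ∃ z < v, R y z) ∧ ∀ v' < v, ¬ ∀ y < n, ∃ z < v', R y z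

theorem LeastBound.eq {R : ℕ → ℕ → Prop} {n v v' : ℕ} (h : LeastBound R n v)
    (h' : LeastBound R n v') : v = v' := by
  rcases lt_trichotomy v v' with hlt | heq | hlt
  · exact absurd h.1 (h'.2 v hlt)
  · exact heq
  · exact absurd h'.1 (h.2 v' hlt)

theorem exists_leastBound {R : ℕ → ℕ → Prop} (h : ∀ y, ∃ z, R y z) (n : ℕ) :
    ∃ v, LeastBound R n v := by
  classical
  choose g hg using h
  have hex : ∃ v, ∀ y < n, ∃ z < v, R y z :=
    ⟨(Finset.range n).sup g + 1, fun y hy =>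
      ⟨g y, Nat.lt_succ_of_le (Finset.le_sup (Finset.mem_range.2 hy)), hg y⟩⟩
  exact ⟨Nat.find hex, Nat.find_spec hex, fun v' hv' => Nat.find_min hex hv'⟩

/-- Stage `⟨x, n, v⟩` votes for `x` when `v` is the least bound for `n`. Leastness allows one vote
per `n`, so there are infinitely many votes iff every `y` has a witness. Other stages take their own
number as value, which adds at most one element to each fiber. -/
theorem infinite_fiber_iff (R : ℕ → ℕ → ℕ → Prop) (t : ℕ → ℕ)
    (h₁ : ∀ x n v, LeastBound (R x) n v → t (Nat.pair x (Nat.pair n v)) = x)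
    (h₂ : ∀ x n v, ¬ LeastBound (R x) n v →
      t (Nat.pair x (Nat.pair n v)) = Nat.pair x (Nat.pair n v)) (x : ℕ) :
    {s | t s = x}.Infinite ↔ ∀ y, ∃ z, R x y z := by
  constructor
  · contrapose!
    rintro ⟨y, hy⟩
    -- Only `n ≤ y` can have a least bound when `y` has no witness; `{x}` covers the stage `s = x`
    -- with its default value.
    suffices h : {s | t s = x} ⊆ {x} ∪ {s | ∃ n ≤ y, ∃ v, LeastBound (R x) n v ∧
        s = Nat.pair x (Nat.pair n v)} by
      refine (((Set.finite_singleton x).union ?_).subset h)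
      refine Set.Finite.of_injOn (f := fun s => s.unpair.2.unpair.1) (t := Set.Iic y)
        ?_ ?_ (Set.finite_Iic y)
      · rintro _ ⟨n, hn, v, -, rfl⟩
        simpa using hn
      · rintro _ ⟨n, hn, v, hv, rfl⟩ _ ⟨n', hn', v', hv', rfl⟩ heq
        obtain rfl : n = n' := by simpa using heq
        rw [hv.eq hv']
    intro s hs
    obtain ⟨x', n, v, rfl⟩ : ∃ x' n v, s = Nat.pair x' (Nat.pair n v) :=
      ⟨s.unpair.1, s.unpair.2.unpair.1, s.unpair.2.unpair.2, by simp⟩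
    by_cases hb : LeastBound (R x') n v
    · obtain rfl : x' = x := (h₁ _ _ _ hb).symm.trans hs
      refine Or.inr ⟨n, ?_, v, hb, rfl⟩
      by_contra hlt
      obtain ⟨z, -, hz⟩ := hb.1 y (not_le.1 hlt)
      exact hy z hz
    · exact Or.inl ((h₂ _ _ _ hb).symm.trans hs)
  · intro h
    choose v hv using exists_leastBound h
    refine Set.infinite_of_injective_forall_mem (f := fun n => Nat.pair x (Nat.pair n (v n)))
      (fun n n' heq => ?_) fun n => h₁ _ _ _ (hv n)
    simpa using congrArg (fun s => s.unpair.2.unpair.1) heq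

theorem computablePred_leastBound {α : Type*} [Primcodable α] {R : α × ℕ × ℕ → Prop}
    (hR : ComputablePred R) :
    ComputablePred fun a : α × ℕ × ℕ => LeastBound (fun y z => R (a.1, y, z)) a.2.1 a.2.2 := by
  have h₁ : ComputablePred fun b : ((α × ℕ) × ℕ) × ℕ => R (b.1.1.1, b.1.2, b.2) :=
    hR.comp ((Computable.fst.comp (Computable.fst.comp Computable.fst)).pair
      ((Computable.snd.comp Computable.fst).pair Computable.snd))
  have h₂ : ComputablePred fun b : (α × ℕ) × ℕ => ∃ z < b.1.2, R (b.1.1, b.2, z) :=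
    -- The constant 0 fills a coordinate that `h₁` ignores.
    h₁.exists_lt.comp (((Computable.fst.comp Computable.fst).pair
      (Computable.const 0)).pair Computable.snd |>.pair (Computable.snd.comp Computable.fst))
  have h₃ : ComputablePred fun b : α × ℕ × ℕ => ∀ y < b.2.1, ∃ z < b.2.2, R (b.1, y, z) :=
    h₂.forall_lt.comp ((Computable.fst.pair (Computable.snd.comp Computable.snd)).pair
      (Computable.fst.comp Computable.snd))
  have h₄ : ComputablePred fun b : (α × ℕ) × ℕ => ¬ ∀ y < b.1.2, ∃ z < b.2, R (b.1.1, y, z) :=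
    (h₃.comp ((Computable.fst.comp Computable.fst).pair
      ((Computable.snd.comp Computable.fst).pair Computable.snd))).not
  exact h₃.and (h₄.forall_lt.comp ((Computable.fst.pair
    (Computable.fst.comp Computable.snd)).pair (Computable.snd.comp Computable.snd)))

theorem exists_reduction_to_COF {S : ℕ → Prop} (hS : IsSigma 3 S) :
    ∃ g : ℕ → ℕ, Computable g ∧ ∀ e, S e ↔ g e ∈ COF := by
  obtain ⟨R, hR, hS⟩ := isSigma_three_iff.1 hS
  let E : ℕ × ℕ → Prop := fun a =>
    LeastBound (fun y z => R (((a.1, a.2.unpair.1), y), z)) a.2.unpair.2.unpair.1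
      a.2.unpair.2.unpair.2
  have hE : ComputablePred E := by
    have hR' : ComputablePred fun b : (ℕ × ℕ) × ℕ × ℕ => R ((b.1, b.2.1), b.2.2) :=
      hR.comp ((Computable.fst.pair (Computable.fst.comp Computable.snd)).pair
        (Computable.snd.comp Computable.snd))
    have hu := Computable.unpair.comp (Computable.snd (α := ℕ) (β := ℕ))
    exact (computablePred_leastBound hR').comp ((Computable.fst.pair (Computable.fst.comp hu)).pair
      (Computable.unpair.comp (Computable.snd.comp hu)))
  obtain ⟨b, hb, hEb⟩ := ComputablePred.computable_iff.1 hE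
  let t : ℕ × ℕ → ℕ := fun a => bif b a then a.2.unpair.1 else a.2
  have ht : Computable t :=
    Computable.cond hb (Computable.fst.comp (Computable.unpair.comp Computable.snd)) Computable.snd
  have hp : ComputablePred fun c : (ℕ × ℕ) × ℕ => c.1.2 < c.2 ∧ t (c.1.1, c.2) ≤ t c.1 := by
    refine (ComputablePred.comp (p := fun a : ℕ × ℕ => a.1 < a.2)
      (PrimrecPred.computablePred Primrec.nat_lt)
      ((Computable.snd.comp Computable.fst).pair Computable.snd)).and
      (ComputablePred.comp (p := fun a : ℕ × ℕ => a.1 ≤ a.2)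
      (PrimrecPred.computablePred Primrec.nat_le) ((ht.comp ((Computable.fst.comp
        Computable.fst).pair Computable.snd)).pair (ht.comp Computable.fst)))
  obtain ⟨g, hg, hgW⟩ := exists_W_index hp
  refine ⟨g, hg, fun e => ?_⟩
  have hW : W (g e) = {s | ∃ s' > s, t (e, s') ≤ t (e, s)} := Set.ext fun s => hgW e s
  have hbE (a) : b a = true ↔ E a := by rw [hEb]
  change S e ↔ (W (g e))ᶜ.Finite
  rw [hS, hW, finite_compl_iff_exists_infinite_fiber fun s => t (e, s)]
  refine exists_congr fun x => (infinite_fiber_iff (fun x y z => R (((e, x), y), z)) _ ?_ ?_ x).symm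
  · intro x n v h
    have : b (e, Nat.pair x (Nat.pair n v)) = true := (hbE _).2 (by simpa [E] using h)
    simp [t, this]
  · intro x n v h
    have : b (e, Nat.pair x (Nat.pair n v)) = false :=
      Bool.eq_false_iff.2 fun hc => h (by simpa [E] using (hbE _).1 hc)
    simp [t, this]

end RecPres

/-! ### Finiteness of the presented group is Σ₃. -/

namespace RecPres

abbrev Word : Type := List (ℕ × Bool)

/-- Decoding of natural numbers, made total. -/
def decodeD {α : Type} [Primcodable α] [Inhabited α] (n : ℕ) : α :=
  (Encodable.decode n).getD default

theorem decodeD_encode {α : Type} [Primcodable α] [Inhabited α] (a : α) :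
    decodeD (Encodable.encode a) = a := by
  simp [decodeD]

theorem primrec_decodeD {α : Type} [Primcodable α] [Inhabited α] :
    Primrec (decodeD : ℕ → α) :=
  Primrec.option_getD.comp Primrec.decode (Primrec.const default)

theorem primrec_invRev : Primrec (FreeGroup.invRev : Word → Word) :=
  Primrec.list_reverse.comp (Primrec.list_map Primrec.id
    (((Primrec.fst.comp Primrec.snd).pair
      (Primrec.not.comp (Primrec.snd.comp Primrec.snd))).to₂))

theorem primrec_reduce : Primrec (FreeGroup.reduce : Word → Word) := by
  let step : (ℕ × Bool) × Word → Word := fun p =>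
    List.casesOn p.2 [p.1] fun hd tl => if p.1.1 = hd.1 ∧ p.1.2 = !hd.2 then tl else p.1 :: hd :: tl
  have hstep : Primrec step := by
    refine Primrec.list_casesOn (h := fun (p : (ℕ × Bool) × Word) (b : (ℕ × Bool) × Word) =>
      if p.1.1 = b.1.1 ∧ p.1.2 = !b.1.2 then b.2 else p.1 :: b.1 :: b.2) Primrec.snd
      (Primrec.list_cons.comp Primrec.fst (Primrec.const [])) ?_
    refine Primrec.ite (PrimrecPred.and ?_ ?_) ?_ ?_
    · exact Primrec.eq.comp (Primrec.fst.comp (Primrec.fst.comp Primrec.fst))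
        (Primrec.fst.comp (Primrec.fst.comp Primrec.snd))
    · exact Primrec.eq.comp (Primrec.snd.comp (Primrec.fst.comp Primrec.fst))
        (Primrec.not.comp (Primrec.snd.comp (Primrec.fst.comp Primrec.snd)))
    · exact Primrec.snd.comp Primrec.snd
    · exact Primrec.list_cons.comp (Primrec.fst.comp Primrec.fst)
        (Primrec.list_cons.comp (Primrec.fst.comp Primrec.snd) (Primrec.snd.comp Primrec.snd))
  refine (Primrec.list_foldr (h := fun _ p => step p) Primrec.id (Primrec.const [])
    ((hstep.comp Primrec.snd).to₂)).of_eq fun w => ?_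
  induction w with
  | nil => rfl
  | cons a w ih => exact congrArg (fun v => step (a, v)) ih

/-- The word `u r u⁻¹` or `u r⁻¹ u⁻¹` for `d = (u, (r, k), s)`, depending on the sign `s`. -/
def conjWord (d : Word × (Word × ℕ) × Bool) : Word :=
  d.1 ++ ((bif d.2.2 then d.2.1.1 else FreeGroup.invRev d.2.1.1) ++ FreeGroup.invRev d.1)

theorem primrec_conjWord : Primrec conjWord := by
  have hr : Primrec fun d : Word × (Word × ℕ) × Bool => d.2.1.1 :=
    Primrec.fst.comp (Primrec.fst.comp Primrec.snd)
  exact Primrec.list_append.comp Primrec.fst (Primrec.list_append.comp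
    (Primrec.cond (Primrec.snd.comp Primrec.snd) hr (primrec_invRev.comp hr))
    (primrec_invRev.comp Primrec.fst))

theorem mk_conjWord_true (u r : Word) (k : ℕ) : FreeGroup.mk (conjWord (u, (r, k), true)) =
    FreeGroup.mk u * FreeGroup.mk r * (FreeGroup.mk u)⁻¹ := by
  simp [conjWord, FreeGroup.inv_mk, FreeGroup.mul_mk]

theorem mk_conjWord_false (u r : Word) (k : ℕ) : FreeGroup.mk (conjWord (u, (r, k), false)) =
    (FreeGroup.mk u * FreeGroup.mk r * (FreeGroup.mk u)⁻¹)⁻¹ := by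
  simp [conjWord, FreeGroup.inv_mk, FreeGroup.mul_mk, FreeGroup.invRev_append, FreeGroup.invRev_invRev]

/-- The normal closure is generated by conjugates of relators, so its elements are products of these
and their inverses. Each factor carries the stage `k`, so a computable `C` makes the witness
checkable; comparing reduced words decides equality in the free group. -/
theorem mk_mem_normalClosure_iff (C : Word × ℕ → Prop) (w : Word) :
    FreeGroup.mk w ∈ Subgroup.normalClosure (FreeGroup.mk '' {r | ∃ k, C (r, k)}) ↔
    ∃ ds : List (Word × (Word × ℕ) × Bool), (∀ d ∈ ds, C d.2.1) ∧
      FreeGroup.reduce w = FreeGroup.reduce (ds.flatMap conjWord) := by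
  have hred : ∀ v : Word, FreeGroup.reduce w = FreeGroup.reduce v ↔
      FreeGroup.mk w = FreeGroup.mk v := fun v =>
    ⟨FreeGroup.reduce.exact, fun h => by simpa using congrArg FreeGroup.toWord h⟩
  simp only [hred]
  generalize FreeGroup.mk w = x
  constructor
  · intro h
    have hconj : ∀ y ∈ Group.conjugatesOfSet (FreeGroup.mk '' {r | ∃ k, C (r, k)}),
        ∃ u r k, C (r, k) ∧ y = FreeGroup.mk u * FreeGroup.mk r * (FreeGroup.mk u)⁻¹ := by
      intro y hy
      obtain ⟨_, ⟨r, ⟨k, hr⟩, rfl⟩, hy⟩ := Group.mem_conjugatesOfSet_iff.1 hy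
      obtain ⟨c, rfl⟩ := isConj_iff.1 hy
      exact ⟨c.toWord, r, k, hr, by rw [FreeGroup.mk_toWord]⟩
    refine Subgroup.closure_induction_left (p := fun x _ =>
      ∃ ds : List (Word × (Word × ℕ) × Bool), (∀ d ∈ ds, C d.2.1) ∧
      x = FreeGroup.mk (ds.flatMap conjWord)) ⟨[], by simp, rfl⟩ ?_ ?_ h
    · rintro y hy _ - ⟨ds, hds, rfl⟩
      obtain ⟨u, r, k, hr, rfl⟩ := hconj y hy
      refine ⟨(u, (r, k), true) :: ds, by simpa using ⟨hr, by simpa using hds⟩, ?_⟩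
      rw [List.flatMap_cons, ← FreeGroup.mul_mk, mk_conjWord_true]
    · rintro y hy _ - ⟨ds, hds, rfl⟩
      obtain ⟨u, r, k, hr, rfl⟩ := hconj y hy
      refine ⟨(u, (r, k), false) :: ds, by simpa using ⟨hr, by simpa using hds⟩, ?_⟩
      rw [List.flatMap_cons, ← FreeGroup.mul_mk, mk_conjWord_false]
  · rintro ⟨ds, hds, rfl⟩
    induction ds with
    | nil => exact one_mem _
    | cons d ds ih =>
      rw [List.flatMap_cons, ← FreeGroup.mul_mk]
      refine mul_mem ?_ (ih fun d' hd' => hds d' (List.mem_cons_of_mem _ hd'))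
      obtain ⟨u, ⟨r, k⟩, s⟩ := d
      have hr := Subgroup.normalClosure_normal.conj_mem _ (Subgroup.subset_normalClosure
        (s := FreeGroup.mk '' {r | ∃ k, C (r, k)})
        ⟨r, ⟨k, hds _ List.mem_cons_self⟩, rfl⟩) (FreeGroup.mk u)
      cases s
      · rw [mk_conjWord_false]; exact inv_mem hr
      · rw [mk_conjWord_true]; exact hr

theorem finite_presentedGroup_iff (R : Set (FreeGroup ℕ)) :
    Finite (PresentedGroup R) ↔ ∃ L : List Word, ∀ w : Word, ∃ i : ℕ,
      FreeGroup.mk (w ++ FreeGroup.invRev (L.getD i [])) ∈ Subgroup.normalClosure R := by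
  have key : ∀ v w : Word, FreeGroup.mk (w ++ FreeGroup.invRev v) ∈ Subgroup.normalClosure R ↔
      PresentedGroup.mk R (FreeGroup.mk w) = PresentedGroup.mk R (FreeGroup.mk v) := by
    intro v w
    rw [← PresentedGroup.mk_eq_one_iff, ← FreeGroup.mul_mk, ← FreeGroup.inv_mk, map_mul, map_inv,
      mul_inv_eq_one]
  have hsurj : ∀ g : PresentedGroup R, ∃ w : Word, PresentedGroup.mk R (FreeGroup.mk w) = g := by
    intro g
    obtain ⟨x, rfl⟩ := PresentedGroup.mk_surjective R g
    exact ⟨x.toWord, by rw [FreeGroup.mk_toWord]⟩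
  simp only [key]
  constructor
  · intro h
    have := Fintype.ofFinite (PresentedGroup R)
    choose rep hrep using hsurj
    refine ⟨(Finset.univ : Finset (PresentedGroup R)).toList.map rep, fun w => ?_⟩
    obtain ⟨i, hi, h⟩ := List.getElem_of_mem (List.mem_map_of_mem (f := rep) (Finset.mem_toList.2
      (Finset.mem_univ (PresentedGroup.mk R (FreeGroup.mk w)))))
    exact ⟨i, by rw [List.getD_eq_getElem _ _ hi, h, hrep]⟩
  · rintro ⟨L, hL⟩
    -- The empty word is added because `getD` returns it when `i` is out of range.
    refine Set.finite_univ_iff.1 ((List.finite_toSet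
      (([] :: L).map fun v => PresentedGroup.mk R (FreeGroup.mk v))).subset fun g _ => ?_)
    obtain ⟨w, rfl⟩ := hsurj g
    obtain ⟨i, hi⟩ := hL w
    refine List.mem_map.2 ⟨_, ?_, hi.symm⟩
    by_cases h : i < L.length
    · rw [List.getD_eq_getElem _ _ h]; exact List.mem_cons_of_mem _ (List.getElem_mem h)
    · rw [List.getD_eq_default _ _ (not_lt.1 h)]; exact List.mem_cons_self

/-- The stage `k` verifies that the word `r` is a relator in the index `e`, or a
single letter which is not a generator. -/
def RelatorAt (e : ℕ) (a : Word × ℕ) : Prop :=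
  (Code.evaln a.2 (Denumerable.ofNat Code e.unpair.2) (Encodable.encode a.1)).isSome = true ∨
  (a.1 = [(a.1.headI.1, true)] ∧
    Code.evaln a.2 (Denumerable.ofNat Code e.unpair.1) a.1.headI.1 = some 0)

theorem primrecRel_relatorAt : PrimrecRel fun (a : Word × ℕ) (e : ℕ) => RelatorAt e a := by
  have ha : Primrec fun p : (Word × ℕ) × ℕ => p.1.1 := Primrec.fst.comp Primrec.fst
  have hh : Primrec fun p : (Word × ℕ) × ℕ => p.1.1.headI.1 :=
    Primrec.fst.comp (Primrec.list_headI.comp ha)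
  have hk : Primrec fun p : (Word × ℕ) × ℕ => p.1.2 := Primrec.snd.comp Primrec.fst
  have hu : Primrec fun p : (Word × ℕ) × ℕ => p.2.unpair := Primrec.unpair.comp Primrec.snd
  have hev {c : (Word × ℕ) × ℕ → ℕ} {m : (Word × ℕ) × ℕ → ℕ} (hc : Primrec c) (hm : Primrec m) :
      Primrec fun p => Code.evaln p.1.2 (Denumerable.ofNat Code (c p)) (m p) :=
    Code.primrec_evaln.comp ((hk.pair ((Primrec.ofNat Code).comp hc)).pair hm)
  exact (PrimrecPred.or (Primrec.eq.comp (Primrec.option_isSome.comp (hev (Primrec.snd.comp hu)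
      (Primrec.encode.comp ha))) (Primrec.const true))
    (PrimrecPred.and (Primrec.eq.comp ha (Primrec.list_cons.comp (hh.pair (Primrec.const true))
      (Primrec.const []))) (Primrec.eq.comp (hev (Primrec.fst.comp hu) hh)
        (Primrec.const (some 0)))))

/-- The relators of the index `e` in the free group on all of `ℕ`, together with the letters that
are not generators. -/
def fullRelators (e : ℕ) : Set (FreeGroup ℕ) :=
  FreeGroup.mk '' {r | ∃ k, RelatorAt e (r, k)}

theorem mem_fullRelators_iff {e : ℕ} {x : FreeGroup ℕ} : x ∈ fullRelators e ↔
    (∃ w : Word, Encodable.encode w ∈ W e.unpair.2 ∧ x = FreeGroup.mk w) ∨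
    ∃ n, 0 ∈ phi e.unpair.1 n ∧ x = FreeGroup.of n := by
  simp only [mem_W_iff, phi, Code.evaln_complete]
  constructor
  · rintro ⟨r, ⟨k, h | ⟨h, h'⟩⟩, rfl⟩
    · exact Or.inl ⟨r, ⟨k, h⟩, rfl⟩
    · exact Or.inr ⟨_, ⟨k, h'⟩, congrArg FreeGroup.mk h⟩
  · rintro (⟨r, ⟨k, h⟩, rfl⟩ | ⟨n, ⟨k, h⟩, rfl⟩)
    · exact ⟨r, ⟨k, Or.inl h⟩, rfl⟩
    · exact ⟨[(n, true)], ⟨k, Or.inr ⟨rfl, h⟩⟩, rfl⟩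

/-- The quantifiers range over codes of a list of representatives, of a word, and of a pair
(position in the list, product of conjugates). -/
theorem isSigma_finite_fullRelators :
    IsSigma 3 fun e => Finite (PresentedGroup (fullRelators e)) := by
  let D := List (Word × (Word × ℕ) × Bool)
  rw [isSigma_three_iff]
  refine ⟨fun p => (∀ d ∈ (decodeD p.2 : ℕ × D).2, RelatorAt p.1.1.1 d.2.1) ∧
    FreeGroup.reduce ((decodeD p.1.2 : Word) ++ FreeGroup.invRev
      ((decodeD p.1.1.2 : List Word).getD (decodeD p.2 : ℕ × D).1 [])) =
    FreeGroup.reduce ((decodeD p.2 : ℕ × D).2.flatMap conjWord), ?_, fun e => ?_⟩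
  · have hz : Primrec fun p : ((ℕ × ℕ) × ℕ) × ℕ => (decodeD p.2 : ℕ × D) :=
      primrec_decodeD.comp Primrec.snd
    have hds := Primrec.snd.comp hz
    refine PrimrecPred.computablePred (PrimrecPred.and ?_ (Primrec.eq.comp
      (primrec_reduce.comp ?_) (primrec_reduce.comp ?_)))
    · have hR : PrimrecRel fun (d : Word × (Word × ℕ) × Bool) (e : ℕ) => RelatorAt e d.2.1 :=
        primrecRel_relatorAt.comp ((Primrec.fst.comp (Primrec.snd.comp Primrec.fst)))
          Primrec.snd
      exact hR.forall_mem_list.comp hds (Primrec.fst.comp (Primrec.fst.comp Primrec.fst))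
    · exact Primrec.list_append.comp (primrec_decodeD.comp (Primrec.snd.comp Primrec.fst))
        (primrec_invRev.comp ((Primrec.list_getD []).comp
          (primrec_decodeD.comp (Primrec.snd.comp (Primrec.fst.comp Primrec.fst)))
          (Primrec.fst.comp hz)))
    · exact Primrec.list_flatMap hds ((primrec_conjWord.comp Primrec.snd).to₂)
  · rw [finite_presentedGroup_iff]
    simp only [fullRelators, mk_mem_normalClosure_iff]
    constructor
    · rintro ⟨L, hL⟩
      refine ⟨Encodable.encode L, fun y => ?_⟩
      obtain ⟨i, ds, h⟩ := hL (decodeD y)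
      exact ⟨Encodable.encode (i, ds), by simpa only [decodeD_encode] using h⟩
    · rintro ⟨x, hx⟩
      refine ⟨decodeD x, fun w => ?_⟩
      obtain ⟨z, hz⟩ := hx (Encodable.encode w)
      exact ⟨(decodeD z : ℕ × D).1, (decodeD z : ℕ × D).2, by
        simpa only [decodeD_encode] using hz⟩

theorem exists_map_val_eq {s : Set ℕ} {w : Word} (hw : ∀ l ∈ w, l.1 ∈ s) :
    ∃ v : List (s × Bool), v.map (fun l => ((l.1 : ℕ), l.2)) = w :=
  ⟨w.pmap (fun l hl => (⟨l.1, hl⟩, l.2)) hw, by simp [List.map_pmap]⟩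

/-- The generators map to one another in both directions and non-generators are trivial, so each
group surjects onto the other. -/
theorem finite_rpGroup_iff {e : ℕ} (he : e ∈ rpIndices) :
    Finite (RPGroup e) ↔ Finite (PresentedGroup (fullRelators e)) := by
  classical
  constructor
  · intro h
    have hrel : ∀ r ∈ relators e, FreeGroup.lift (fun n : gens e =>
        (PresentedGroup.of (n : ℕ) : PresentedGroup (fullRelators e))) r = 1 := by
      rintro _ ⟨w, hw, rfl⟩
      -- Writing 1 as the class of the relator turns the claim into equality of two homomorphisms,
      -- tested on generators.
      rw [← PresentedGroup.one_of_mem (mem_fullRelators_iff.2 (Or.inl ⟨_, hw, rfl⟩))]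
      rw [← FreeGroup.map.mk (f := Subtype.val), ← MonoidHom.comp_apply]
      refine DFunLike.congr_fun (FreeGroup.ext_hom _ _ fun n => ?_) _
      simp [PresentedGroup.of]
    refine Finite.of_surjective (PresentedGroup.toGroup hrel) (MonoidHom.range_eq_top.1 ?_)
    refine (Subgroup.eq_top_iff' _).2 (PresentedGroup.generated_by _ _ fun n => ?_)
    rcases he.1 n with h0 | h1
    · rw [show (PresentedGroup.of n : PresentedGroup (fullRelators e)) = 1 from
        PresentedGroup.one_of_mem (mem_fullRelators_iff.2 (Or.inr ⟨n, by simp [h0], rfl⟩))]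
      exact one_mem _
    · exact ⟨PresentedGroup.of ⟨n, by simp [gens, h1]⟩, PresentedGroup.toGroup.of hrel⟩
  · intro h
    let f : ℕ → RPGroup e := fun n => if hn : n ∈ gens e then PresentedGroup.of ⟨n, hn⟩ else 1
    have hf (n : gens e) : f n = PresentedGroup.of n := by simp [f]
    have hrel : ∀ r ∈ fullRelators e, FreeGroup.lift f r = 1 := by
      intro r hr
      rcases mem_fullRelators_iff.1 hr with ⟨w, hw, rfl⟩ | ⟨n, hn, rfl⟩
      · obtain ⟨w', hw', hg⟩ := he.2 _ hw
        obtain rfl := Encodable.encode_injective hw'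
        obtain ⟨v, rfl⟩ := exists_map_val_eq hg
        rw [← PresentedGroup.one_of_mem (rels := relators e) ⟨v, hw, rfl⟩]
        rw [← FreeGroup.map.mk (f := Subtype.val), ← MonoidHom.comp_apply]
        refine DFunLike.congr_fun (FreeGroup.ext_hom _ _ fun n => ?_) _
        simp [hf, PresentedGroup.of]
      · have : n ∉ gens e := fun h1 => zero_ne_one (Part.mem_unique hn h1)
        simp [f, this]
    refine Finite.of_surjective (PresentedGroup.toGroup hrel) (MonoidHom.range_eq_top.1 ?_)
    refine (Subgroup.eq_top_iff' _).2 (PresentedGroup.generated_by _ _ fun n => ?_)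
    exact ⟨PresentedGroup.of n, (PresentedGroup.toGroup.of hrel).trans (hf n)⟩

theorem detectIn_finite : DetectIn (IsSigma 3) rpIndices (fun G _ => Finite G) := by
  refine ⟨_, isSigma_finite_fullRelators, Set.ext fun e => ?_⟩
  exact and_congr_right fun he => (finite_rpGroup_iff he).symm

end RecPres

/-! ### The elementary abelian 2-groups attached to `W e`. -/

namespace RecPres

/-- An elementary abelian `2`-group with generators `x i`, those outside `C` being trivial, is
free on the remaining ones as soon as it maps to the free object in the expected way. -/
theorem nonempty_mulEquiv_finsupp {G : Type*} [CommGroup G] {x : ℕ → G} {C : Set ℕ}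
    (hgen : Subgroup.closure (Set.range x) = ⊤) (hsq : ∀ i, x i ^ 2 = 1)
    (hC : ∀ i ∉ C, x i = 1) (φ : G →* Multiplicative (C →₀ ZMod 2))
    (hφ : ∀ i : C, φ (x i) = Multiplicative.ofAdd (Finsupp.single i 1)) :
    Nonempty (G ≃* Multiplicative (C →₀ ZMod 2)) := by
  -- This is the condition for the map 1 ↦ `x i` to factor through `ZMod 2`.
  have hz (i : C) : zmultiplesHom (Additive G) (Additive.ofMul (x i)) (2 : ℕ) = 0 := by
    simp only [zmultiplesHom_apply, natCast_zsmul]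
    exact congrArg Additive.ofMul (hsq i)
  let a (i : C) : ZMod 2 →+ Additive G := ZMod.lift 2 ⟨_, hz i⟩
  have ha (i : C) : a i 1 = Additive.ofMul (x i) := by
    simpa [a] using ZMod.lift_coe 2 ⟨_, hz i⟩ 1
  let ψ : Multiplicative (C →₀ ZMod 2) →* G :=
    AddMonoidHom.toMultiplicativeLeft (Finsupp.liftAddHom a)
  have hψ (i : C) : ψ (Multiplicative.ofAdd (Finsupp.single i 1)) = x i := by
    change (Finsupp.liftAddHom a (Finsupp.single i 1)).toMul = x i
    simp [ha]
  refine ⟨MonoidHom.toMulEquiv φ ψ ?_ ?_⟩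
  · refine MonoidHom.eq_of_eqOn_dense hgen ?_
    rintro _ ⟨i, rfl⟩
    by_cases hi : i ∈ C
    · simpa [hφ ⟨i, hi⟩] using hψ ⟨i, hi⟩
    · simp [hC i hi]
  · refine MonoidHom.toAdditive.injective (Finsupp.addHom_ext' fun i => ?_)
    refine AddMonoidHom.ext fun c => ?_
    have h1 : φ (ψ (Multiplicative.ofAdd (Finsupp.single i 1))) =
        Multiplicative.ofAdd (Finsupp.single i 1) := by rw [hψ, hφ]
    fin_cases c
    · exact (map_zero _).trans (map_zero _).symm
    · exact congrArg Multiplicative.toAdd h1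

/-- The centralizer of a generator contains all generators, hence is everything; so the centralizer
of any `y` also contains all generators. -/
theorem presentedGroup_mul_comm {α : Type*} {R : Set (FreeGroup α)}
    (h : ∀ i j, (PresentedGroup.of i : PresentedGroup R) * PresentedGroup.of j =
      PresentedGroup.of j * PresentedGroup.of i) (x y : PresentedGroup R) : x * y = y * x := by
  have h₁ (i : α) (y : PresentedGroup R) : y * PresentedGroup.of i = PresentedGroup.of i * y :=
    Subgroup.mem_centralizer_singleton_iff.1 (PresentedGroup.generated_by R
      (Subgroup.centralizer {PresentedGroup.of i})
      (fun j => Subgroup.mem_centralizer_singleton_iff.2 (h j i)) y)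
  exact Subgroup.mem_centralizer_singleton_iff.1 (PresentedGroup.generated_by R
    (Subgroup.centralizer {y})
    (fun j => Subgroup.mem_centralizer_singleton_iff.2 (h₁ j y).symm) x)

theorem nonempty_mulEquiv_cofRelators (e : ℕ) :
    Nonempty (PresentedGroup (cofRelators e) ≃*
      Multiplicative (((W e)ᶜ : Set ℕ) →₀ ZMod 2)) := by
  classical
  have hcomm (i j : ℕ) : (PresentedGroup.of i : PresentedGroup (cofRelators e)) *
      PresentedGroup.of j = PresentedGroup.of j * PresentedGroup.of i := by
    have h : PresentedGroup.mk (cofRelators e) _ = 1 :=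
      PresentedGroup.one_of_mem (Or.inl (Or.inl ⟨i, j, rfl⟩))
    simp only [map_mul, map_inv] at h
    -- Left multiplication by `x_j x_i` turns the commutator relation into `x_i x_j = x_j x_i`.
    have h' := congrArg (fun g => PresentedGroup.mk (cofRelators e) (.of j) *
      PresentedGroup.mk (cofRelators e) (.of i) * g) h
    simpa [PresentedGroup.of, mul_assoc] using h'
  let : CommGroup (PresentedGroup (cofRelators e)) :=
    { (inferInstance : Group (PresentedGroup (cofRelators e))) with
      mul_comm := presentedGroup_mul_comm hcomm }
  let f : ℕ → Multiplicative (((W e)ᶜ : Set ℕ) →₀ ZMod 2) := fun i =>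
    if hi : i ∈ (W e)ᶜ then Multiplicative.ofAdd (Finsupp.single ⟨i, hi⟩ 1) else 1
  have hsq (y : Multiplicative (((W e)ᶜ : Set ℕ) →₀ ZMod 2)) : y ^ 2 = 1 := by
    refine Multiplicative.toAdd.injective (Finsupp.ext fun i => ?_)
    rw [toAdd_pow, two_nsmul]
    exact CharTwo.add_self_eq_zero _
  have hf : ∀ r ∈ cofRelators e, FreeGroup.lift f r = 1 := by
    rintro _ ((⟨i, j, rfl⟩ | ⟨i, rfl⟩) | ⟨k, hk, rfl⟩)
    · simp only [map_mul, map_inv, mul_right_comm _ _ (FreeGroup.lift f (FreeGroup.of i))]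
      simp
    · rw [map_pow, hsq]
    · simp [f, hk]
  refine nonempty_mulEquiv_finsupp (x := PresentedGroup.of) (PresentedGroup.closure_range_of _)
    (fun i => ?_) (fun i hi => ?_) (PresentedGroup.toGroup hf) fun i => ?_
  · exact PresentedGroup.one_of_mem (rels := cofRelators e) (Or.inl (Or.inr ⟨i, rfl⟩))
  · exact PresentedGroup.one_of_mem (rels := cofRelators e)
      (Or.inr ⟨i, by simpa using hi, rfl⟩)
  · exact (PresentedGroup.toGroup.of hf).trans (dif_pos i.2)

theorem nonempty_mulEquiv_fin {C : Set ℕ} {n : ℕ} (hC : C.Finite) (hn : C.ncard = n) :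
    Nonempty (Multiplicative (C →₀ ZMod 2) ≃* Multiplicative (Fin n → ZMod 2)) := by
  have := hC.to_subtype
  have e : C ≃ Fin n := Finite.equivFinOfCardEq hn
  exact ⟨AddEquiv.toMultiplicative ((Finsupp.domCongr e).trans
    (Finsupp.linearEquivFunOnFinite (ZMod 2) (ZMod 2) (Fin n)).toAddEquiv)⟩

theorem nonempty_mulEquiv_nat {C : Set ℕ} (hC : C.Infinite) :
    Nonempty (Multiplicative (C →₀ ZMod 2) ≃* Multiplicative (ℕ →₀ ZMod 2)) := by
  have := hC.to_subtype
  obtain ⟨e⟩ := nonempty_equiv_of_countable (α := C) (β := ℕ)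
  exact ⟨AddEquiv.toMultiplicative (Finsupp.domCongr e)⟩

theorem finite_multiplicative_finsupp_iff {C : Set ℕ} :
    Finite (Multiplicative (C →₀ ZMod 2)) ↔ C.Finite := by
  constructor
  · intro h
    have h' : Finite (C →₀ ZMod 2) := h
    exact Set.finite_coe_iff.1 (Finite.of_injective (fun i : C => Finsupp.single i (1 : ZMod 2))
      (Finsupp.single_left_injective one_ne_zero))
  · intro h
    have := h.to_subtype
    exact Finite.of_injective (β := C → ZMod 2) (fun v => v.toAdd)
      fun v w h => Multiplicative.toAdd.injective (DFunLike.coe_injective h)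

/-- The words `[x_i, x_j]` and `x_i ^ 2`, and `x_k` for `k ∈ W e`. -/
def cofWords (e : ℕ) : Set Word :=
  {w | (∃ i j, w = [(i, false), (j, false), (i, true), (j, true)]) ∨
    (∃ i, w = [(i, true), (i, true)]) ∨ ∃ k ∈ W e, w = [(k, true)]}

theorem image_mk_cofWords (e : ℕ) : FreeGroup.mk '' cofWords e = cofRelators e := by
  ext r
  constructor
  · rintro ⟨_, ⟨i, j, rfl⟩ | ⟨i, rfl⟩ | ⟨k, hk, rfl⟩, rfl⟩
    · exact Or.inl (Or.inl ⟨i, j, rfl⟩)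
    · exact Or.inl (Or.inr ⟨i, rfl⟩)
    · exact Or.inr ⟨k, hk, rfl⟩
  · rintro ((⟨i, j, rfl⟩ | ⟨i, rfl⟩) | ⟨k, hk, rfl⟩)
    · exact ⟨_, Or.inl ⟨i, j, rfl⟩, rfl⟩
    · exact ⟨_, Or.inr (Or.inl ⟨i, rfl⟩), rfl⟩
    · exact ⟨_, Or.inr (Or.inr ⟨k, hk, rfl⟩), rfl⟩

/-- One search variable codes `(i, j, k)`: two letter indices and a stage at which `i` is seen to
enter `W e`. -/
theorem exists_W_index_cofWords : ∃ g : ℕ → ℕ, Computable g ∧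
    ∀ e, W (g e) = Encodable.encode '' cofWords e := by
  let q (p : (ℕ × ℕ) × ℕ) : ℕ × ℕ × ℕ := decodeD p.2
  have hq : Primrec q := primrec_decodeD.comp Primrec.snd
  have hi : Primrec fun p => (q p).1 := Primrec.fst.comp hq
  have hj : Primrec fun p => (q p).2.1 := Primrec.fst.comp (Primrec.snd.comp hq)
  have hk : Primrec fun p => (q p).2.2 := Primrec.snd.comp (Primrec.snd.comp hq)
  have hm : Primrec fun p : (ℕ × ℕ) × ℕ => p.1.2 := Primrec.snd.comp Primrec.fst
  have hcons {i : (ℕ × ℕ) × ℕ → ℕ} {w : (ℕ × ℕ) × ℕ → Word} (b : Bool) (hi : Primrec i)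
      (hw : Primrec w) : Primrec fun p => (i p, b) :: w p :=
    Primrec.list_cons.comp (hi.pair (Primrec.const b)) hw
  have hnil : Primrec fun _ : (ℕ × ℕ) × ℕ => ([] : Word) := Primrec.const []
  have hp := ((Primrec.eq.comp hm (Primrec.encode.comp
    (hcons false hi (hcons false hj (hcons true hi (hcons true hj hnil)))))).or
    ((Primrec.eq.comp hm (Primrec.encode.comp (hcons true hi (hcons true hi hnil)))).or
    ((Primrec.eq.comp hm (Primrec.encode.comp (hcons true hi hnil))).and
    (Primrec.eq.comp (Primrec.option_isSome.comp (Code.primrec_evaln.comp ((hk.pair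
      ((Primrec.ofNat Code).comp (Primrec.fst.comp Primrec.fst))).pair hi)))
      (Primrec.const true))))).computablePred
  obtain ⟨g, hg, hW⟩ := exists_W_index hp
  refine ⟨g, hg, fun e => Set.ext fun m => (hW e m).trans ?_⟩
  constructor
  · rintro ⟨z, h | h | ⟨h, h'⟩⟩
    · exact ⟨_, Or.inl ⟨_, _, rfl⟩, h.symm⟩
    · exact ⟨_, Or.inr (Or.inl ⟨_, rfl⟩), h.symm⟩
    · exact ⟨_, Or.inr (Or.inr ⟨_, mem_W_iff.2 ⟨_, h'⟩, rfl⟩), h.symm⟩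
  · rintro ⟨_, ⟨i, j, rfl⟩ | ⟨i, rfl⟩ | ⟨i, hi, rfl⟩, rfl⟩
    · exact ⟨Encodable.encode (i, j, 0), Or.inl (by simp only [q, decodeD_encode])⟩
    · exact ⟨Encodable.encode (i, 0, 0), Or.inr (Or.inl (by simp only [q, decodeD_encode]))⟩
    · obtain ⟨k, hk⟩ := mem_W_iff.1 hi
      refine ⟨Encodable.encode (i, 0, k), Or.inr (Or.inr ⟨?_, ?_⟩)⟩
      · simp only [q, decodeD_encode]
      · simpa only [q, decodeD_encode] using hk

theorem image_map_val_relators {e : ℕ} (he : gens e = Set.univ) :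
    FreeGroup.map (Subtype.val : gens e → ℕ) '' relators e =
      FreeGroup.mk '' {w | Encodable.encode w ∈ W e.unpair.2} := by
  ext r
  constructor
  · rintro ⟨_, ⟨w, hw, rfl⟩, rfl⟩
    exact ⟨_, hw, (FreeGroup.map.mk).symm⟩
  · rintro ⟨w, hw, rfl⟩
    obtain ⟨v, rfl⟩ := exists_map_val_eq (s := gens e) (w := w) (by simp [he])
    exact ⟨_, ⟨v, hw, rfl⟩, FreeGroup.map.mk⟩

theorem nonempty_mulEquiv_of_image_eq {e : ℕ} (he : gens e = Set.univ) {R : Set (FreeGroup ℕ)}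
    (hR : FreeGroup.map (Subtype.val : gens e → ℕ) '' relators e = R) :
    Nonempty (RPGroup e ≃* PresentedGroup R) := by
  subst hR
  exact ⟨PresentedGroup.equivPresentedGroup (relators e)
    (Equiv.subtypeUnivEquiv fun n => he ▸ Set.mem_univ n)⟩

theorem exists_cof_index : ∃ f : ℕ → ℕ, Computable f ∧ ∀ e,
    f e ∈ rpIndices ∧ gens (f e) = Set.univ ∧
      FreeGroup.map (Subtype.val : gens (f e) → ℕ) '' relators (f e) = cofRelators e := by
  obtain ⟨g, hg, hW⟩ := exists_W_index_cofWords
  -- The constant function 1 makes every natural number a generator.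
  refine ⟨fun e => Nat.pair (Encodable.encode (Code.const 1)) (g e),
    Primrec₂.natPair.to_comp.comp (Computable.const _) hg, fun e => ?_⟩
  have hphi (n : ℕ) : phi (Encodable.encode (Code.const 1)) n = Part.some 1 := by
    simp [phi, Code.eval_const]
  have hgens : gens (Nat.pair (Encodable.encode (Code.const 1)) (g e)) = Set.univ :=
    Set.eq_univ_of_forall fun n => by simp [gens, hphi]
  refine ⟨⟨fun n => Or.inr (by simp [hphi]), fun m hm => ?_⟩, hgens, ?_⟩
  · rw [Nat.unpair_pair, hW] at hm
    obtain ⟨w, -, rfl⟩ := hm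
    exact ⟨w, rfl, fun l _ => hgens ▸ Set.mem_univ _⟩
  · rw [image_map_val_relators hgens, Nat.unpair_pair, hW, ← image_mk_cofWords]
    congr 1
    exact Set.preimage_image_eq _ Encodable.encode_injective

end RecPres

theorem mainTheorem6 :
    RecPres.DetectComplete (RecPres.IsSigma 3) RecPres.rpIndices (fun G _ => Finite G) ∧
    ∃ f : ℕ → ℕ, Computable f ∧ ∀ e : ℕ,
      f e ∈ RecPres.rpIndices ∧
      RecPres.gens (f e) = Set.univ ∧
      (FreeGroup.map (Subtype.val : RecPres.gens (f e) → ℕ)) '' RecPres.relators (f e) =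
        RecPres.cofRelators e ∧
      (e ∈ RecPres.COF ↔
        f e ∈ RecPres.indicesWith RecPres.rpIndices (fun G _ => Finite G)) ∧
      (∀ n : ℕ, (RecPres.W e)ᶜ.Finite → (RecPres.W e)ᶜ.ncard = n →
        Nonempty (RecPres.RPGroup (f e) ≃* Multiplicative (Fin n → ZMod 2))) ∧
      ((RecPres.W e)ᶜ.Infinite →
        Nonempty (RecPres.RPGroup (f e) ≃* Multiplicative (ℕ →₀ ZMod 2))) := by
  obtain ⟨f, hf, hfe⟩ := RecPres.exists_cof_index
  have hiso (e : ℕ) : Nonempty (RecPres.RPGroup (f e) ≃*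
      Multiplicative (((RecPres.W e)ᶜ : Set ℕ) →₀ ZMod 2)) := by
    obtain ⟨φ⟩ := RecPres.nonempty_mulEquiv_of_image_eq (hfe e).2.1 (hfe e).2.2
    obtain ⟨ψ⟩ := RecPres.nonempty_mulEquiv_cofRelators e
    exact ⟨φ.trans ψ⟩
  have hcof (e : ℕ) : e ∈ RecPres.COF ↔
      f e ∈ RecPres.indicesWith RecPres.rpIndices (fun G _ => Finite G) := by
    obtain ⟨φ⟩ := hiso e
    exact (RecPres.finite_multiplicative_finsupp_iff.symm.trans φ.toEquiv.finite_iff.symm).trans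
      (and_iff_right (hfe e).1).symm
  refine ⟨⟨RecPres.detectIn_finite, fun S hS => ?_⟩, f, hf, fun e =>
    ⟨(hfe e).1, (hfe e).2.1, (hfe e).2.2, hcof e, fun n hfin hn => ?_, fun hinf => ?_⟩⟩
  · obtain ⟨g, hg, hgS⟩ := RecPres.exists_reduction_to_COF hS
    exact ⟨f ∘ g, hf.comp hg, fun e => (hfe (g e)).1, fun e => (hgS e).trans (hcof (g e))⟩
  · obtain ⟨φ⟩ := hiso e
    obtain ⟨ψ⟩ := RecPres.nonempty_mulEquiv_fin hfin hn
    exact ⟨φ.trans ψ⟩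
  · obtain ⟨φ⟩ := hiso e
    obtain ⟨ψ⟩ := RecPres.nonempty_mulEquiv_nat hinf
    exact ⟨φ.trans ψ⟩
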